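/- Let $\sigma_0(m)$ denote the number of positive divisors of a positive integer $m$. Let $N$ be a positive integer such that $N\equiv 14\pmod{16}$ or $N\equiv 70\pmod{196}$. Then the number of positive odd integers $k$ such that $k^2<N$ and $\sigma_0(N-k^2)\equiv 2\pmod 4$ is even. -/

import Mathlib

/-! For odd `k`, `m = N - k²` is `1` mod `4`, and not a square since `N` is not a sum of two
squares. Comparing two involutions on the solutions of `x² + 4yz = m`, as in Zagier's proof of
Fermat's theorem, shows that `σ₀(m)/2` has the parity of the number of representations `m = x² +
4y²`. Hence the count of `k` has the parity of the number of solutions of `k² + x² + 4y² = N` with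
`k`, `x` odd. Swapping `k` and `x` is an involution there, and a fixed point would give `2k² + 4y² =
N`, which congruences exclude. -/

theorem Finset.even_card_iff_even_card_fixed {α : Type*} [DecidableEq α] (s : Finset α)
    (f : α → α) (hf : ∀ a ∈ s, f a ∈ s) (hff : ∀ a ∈ s, f (f a) = a) :
    Even s.card ↔ Even (s.filter fun a => f a = a).card := by
  have hmoved : Even (s.filter fun a => ¬ f a = a).card := by
    have hsum : ∑ _a ∈ s.filter (fun a => ¬ f a = a), (1 : ZMod 2) = 0 := by
      refine Finset.sum_involution (fun a _ => f a) (fun _ _ => by decide) ?_ ?_ ?_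
      · intro a ha _
        exact (Finset.mem_filter.1 ha).2
      · intro a ha
        obtain ⟨ha, hne⟩ := Finset.mem_filter.1 ha
        refine Finset.mem_filter.2 ⟨hf a ha, ?_⟩
        rw [hff a ha]
        exact fun h => hne h.symm
      · intro a ha
        exact hff a (Finset.mem_filter.1 ha).1
    rw [Finset.sum_const, nsmul_one, ZMod.natCast_eq_zero_iff] at hsum
    exact even_iff_two_dvd.2 hsum
  rw [← Finset.card_filter_add_card_filter_not (s := s) (fun a => f a = a), Nat.even_add]
  tauto

/-- Positive solutions `(x, y, z)` of `x ^ 2 + 4 * y * z = m`. -/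
def zagierTriples (m : ℕ) : Finset (ℕ × ℕ × ℕ) :=
  (Finset.range (m + 1) ×ˢ Finset.range (m + 1) ×ˢ Finset.range (m + 1)).filter fun t =>
    0 < t.1 ∧ 0 < t.2.1 ∧ 0 < t.2.2 ∧ t.1 ^ 2 + 4 * t.2.1 * t.2.2 = m

theorem mem_zagierTriples {m x y z : ℕ} :
    (x, y, z) ∈ zagierTriples m ↔ 0 < x ∧ 0 < y ∧ 0 < z ∧ x ^ 2 + 4 * y * z = m := by
  simp only [zagierTriples, Finset.mem_filter, Finset.mem_product, Finset.mem_range,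
    and_iff_right_iff_imp]
  rintro ⟨hx, hy, hz, h⟩
  refine ⟨?_, ?_, ?_⟩ <;> nlinarith [Nat.mul_le_mul hy hz, Nat.mul_le_mul hx hx]

/-- Zagier's involution. -/
def zagierMap (t : ℕ × ℕ × ℕ) : ℕ × ℕ × ℕ :=
  if t.1 + t.2.2 < t.2.1 then (t.1 + 2 * t.2.2, t.2.2, t.2.1 - t.1 - t.2.2)
  else if t.1 < 2 * t.2.1 then (2 * t.2.1 - t.1, t.2.1, t.1 + t.2.2 - t.2.1)
  else (t.1 - 2 * t.2.1, t.1 + t.2.2 - t.2.1, t.2.1)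

/-- On the walls between branches of `zagierMap`, where a coordinate of the image would vanish, `m`
is `(x + 2z)²` or divisible by `4`. -/
theorem zagierTriples_boundary {m x y z : ℕ} (h4 : m % 4 = 1) (hsq : ¬ IsSquare m)
    (h : (x, y, z) ∈ zagierTriples m) : x + z ≠ y ∧ x ≠ 2 * y := by
  obtain ⟨hx, hy, hz, h⟩ := mem_zagierTriples.1 h
  constructor
  · rintro rfl
    exact hsq ⟨x + 2 * z, by rw [← h]; ring⟩
  · rintro rfl
    have : m = 4 * (y ^ 2 + y * z) := by rw [← h]; ring
    omega

theorem zagierMap_mem {m : ℕ} (h4 : m % 4 = 1) (hsq : ¬ IsSquare m) (t : ℕ × ℕ × ℕ)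
    (ht : t ∈ zagierTriples m) : zagierMap t ∈ zagierTriples m := by
  obtain ⟨x, y, z⟩ := t
  obtain ⟨h1, h2⟩ := zagierTriples_boundary h4 hsq ht
  obtain ⟨hx, hy, hz, h⟩ := mem_zagierTriples.1 ht
  unfold zagierMap
  dsimp only
  split_ifs with c1 c2
  · obtain ⟨w, rfl⟩ := Nat.exists_eq_add_of_lt c1
    have e : x + z + w + 1 - x - z = w + 1 := by omega
    rw [e]
    refine mem_zagierTriples.2 ⟨by omega, by omega, by omega, ?_⟩
    rw [← h]; ring
  · obtain ⟨w, hw⟩ := Nat.exists_eq_add_of_lt c2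
    obtain ⟨v, hv⟩ := Nat.exists_eq_add_of_lt (show y < x + z by omega)
    have e1 : 2 * y - x = w + 1 := by omega
    have e2 : x + z - y = v + 1 := by omega
    rw [e1, e2]
    refine mem_zagierTriples.2 ⟨by omega, by omega, by omega, ?_⟩
    rw [← h]
    zify at hw hv ⊢
    have a1 : (w : ℤ) = 2 * y - x - 1 := by linarith
    have a2 : (v : ℤ) = x + z - y - 1 := by linarith
    rw [a1, a2]; ring
  · obtain ⟨w, hw⟩ := Nat.exists_eq_add_of_lt (show 2 * y < x by omega)
    have e1 : x - 2 * y = w + 1 := by omega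
    have e2 : x + z - y = w + 1 + y + z := by omega
    rw [e1, e2]
    refine mem_zagierTriples.2 ⟨by omega, by omega, by omega, ?_⟩
    rw [← h, hw]; ring

theorem zagierMap_zagierMap {m : ℕ} (h4 : m % 4 = 1) (hsq : ¬ IsSquare m) (t : ℕ × ℕ × ℕ)
    (ht : t ∈ zagierTriples m) : zagierMap (zagierMap t) = t := by
  obtain ⟨x, y, z⟩ := t
  obtain ⟨h1, h2⟩ := zagierTriples_boundary h4 hsq ht
  obtain ⟨hx, hy, hz, -⟩ := mem_zagierTriples.1 ht
  unfold zagierMap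
  dsimp only
  split_ifs <;> simp only [Prod.mk.injEq, true_and, and_true] <;> dsimp only at * <;> omega

/-- The outer branches strictly change `x`; the middle one fixes it only if `2y - x = x`. -/
theorem zagierMap_eq_self_iff {m x y z : ℕ} (h : (x, y, z) ∈ zagierTriples m) :
    zagierMap (x, y, z) = (x, y, z) ↔ x = y := by
  obtain ⟨hx, hy, hz, -⟩ := mem_zagierTriples.1 h
  unfold zagierMap
  dsimp only
  split_ifs <;> simp only [Prod.mk.injEq, true_and, and_true] <;> omega

theorem Nat.card_divisors_eq_two_mul_card_small {m : ℕ} (hsq : ¬ IsSquare m) :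
    m.divisors.card = 2 * (m.divisors.filter fun d => d * d < m).card := by
  have hflip : (m.divisors.filter fun d => ¬ d * d < m).card =
      (m.divisors.filter fun d => d * d < m).card := by
    refine Finset.card_nbij' (fun d => m / d) (fun d => m / d) ?_ ?_ ?_ ?_
    · intro d hd
      simp only [Finset.coe_filter, Set.mem_ofPred_eq, Nat.mem_divisors] at hd ⊢
      obtain ⟨⟨⟨e, rfl⟩, hm⟩, hlt⟩ := hd
      have hd0 : 0 < d := Nat.pos_of_ne_zero (left_ne_zero_of_mul hm)
      have he0 : 0 < e := Nat.pos_of_ne_zero (right_ne_zero_of_mul hm)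
      rw [Nat.mul_div_cancel_left e hd0]
      refine ⟨⟨Dvd.intro_left d rfl, hm⟩, Nat.mul_lt_mul_of_pos_right ?_ he0⟩
      rcases lt_trichotomy e d with h | rfl | h
      · exact h
      · exact absurd ⟨e, rfl⟩ hsq
      · exact absurd (Nat.mul_lt_mul_of_pos_left h hd0) hlt
    · intro d hd
      simp only [Finset.coe_filter, Set.mem_ofPred_eq, Nat.mem_divisors] at hd ⊢
      obtain ⟨⟨⟨e, rfl⟩, hm⟩, hlt⟩ := hd
      have hd0 : 0 < d := Nat.pos_of_ne_zero (left_ne_zero_of_mul hm)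
      rw [Nat.mul_div_cancel_left e hd0]
      refine ⟨⟨Dvd.intro_left d rfl, hm⟩, not_lt.2 (Nat.mul_le_mul_right e ?_)⟩
      exact (Nat.lt_of_mul_lt_mul_left hlt).le
    · intro d hd
      simp only [Finset.coe_filter, Set.mem_ofPred_eq, Nat.mem_divisors] at hd
      exact Nat.div_div_self hd.1.1 hd.1.2
    · intro d hd
      simp only [Finset.coe_filter, Set.mem_ofPred_eq, Nat.mem_divisors] at hd
      exact Nat.div_div_self hd.1.1 hd.1.2
  rw [← Finset.card_filter_add_card_filter_not (s := m.divisors) (fun d => d * d < m), hflip]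
  ring

/-- A fixed point `(x, x, z)` is a factorization `m = x(x + 4z)`, with `x` the smaller factor. -/
theorem card_zagierMap_fixed {m : ℕ} (h4 : m % 4 = 1) :
    ((zagierTriples m).filter fun t => zagierMap t = t).card =
      (m.divisors.filter fun d => d * d < m).card := by
  refine Finset.card_nbij (fun t => t.1) ?_ ?_ ?_
  · rintro ⟨x, y, z⟩ ht
    obtain ⟨ht, hfix⟩ := Finset.mem_filter.1 ht
    obtain rfl := (zagierMap_eq_self_iff ht).1 hfix
    obtain ⟨hx, -, hz, h⟩ := mem_zagierTriples.1 ht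
    simp only [Finset.coe_filter, Set.mem_ofPred_eq, Nat.mem_divisors]
    refine ⟨⟨⟨x + 4 * z, by rw [← h]; ring⟩, by omega⟩, ?_⟩
    nlinarith [Nat.mul_pos hx hz]
  · rintro ⟨x, y, z⟩ ht ⟨x', y', z'⟩ ht' (rfl : x = x')
    obtain ⟨ht, hfix⟩ := Finset.mem_filter.1 ht
    obtain ⟨ht', hfix'⟩ := Finset.mem_filter.1 ht'
    obtain rfl := (zagierMap_eq_self_iff ht).1 hfix
    obtain rfl := (zagierMap_eq_self_iff ht').1 hfix'
    obtain ⟨hx, -, -, h⟩ := mem_zagierTriples.1 ht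
    obtain ⟨-, -, -, h'⟩ := mem_zagierTriples.1 ht'
    have : 4 * x * z = 4 * x * z' := by omega
    rw [Nat.eq_of_mul_eq_mul_left (by omega) this]
  · intro d hd
    simp only [Finset.coe_filter, Set.mem_ofPred_eq, Nat.mem_divisors] at hd
    obtain ⟨⟨⟨e, he⟩, hm⟩, hlt⟩ := hd
    have hd0 : 0 < d := by
      rcases Nat.eq_zero_or_pos d with rfl | h
      · simp at he; omega
      · exact h
    have hde : d < e := by
      rw [he] at hlt
      exact Nat.lt_of_mul_lt_mul_left hlt
    -- Each unit mod `4` is its own inverse, so `de ≡ 1` forces `d ≡ e`.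
    have hmod : d % 4 = e % 4 := by
      have h1 : (d % 4) * (e % 4) % 4 = 1 := by rw [← Nat.mul_mod, ← he, h4]
      have hd4 : d % 4 < 4 := Nat.mod_lt _ (by norm_num)
      have he4 : e % 4 < 4 := Nat.mod_lt _ (by norm_num)
      generalize d % 4 = a at *
      generalize e % 4 = b at *
      interval_cases a <;> interval_cases b <;> simp_all
    obtain ⟨z, rfl⟩ : ∃ z, e = d + 4 * z := ⟨(e - d) / 4, by omega⟩
    have hmem : (d, d, z) ∈ zagierTriples m :=
      mem_zagierTriples.2 ⟨hd0, hd0, by omega, by rw [he]; ring⟩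
    exact ⟨(d, d, z), Finset.mem_filter.2 ⟨hmem, (zagierMap_eq_self_iff hmem).2 rfl⟩, rfl⟩

/-- Zagier's map has `σ₀(m)/2` fixed points; the swap of `y` and `z` fixes the triples with `y = z`.
Both counts have the parity of the whole set. -/
theorem sigma_zero_modEq_two_iff {m : ℕ} (h4 : m % 4 = 1) (hsq : ¬ IsSquare m) :
    ArithmeticFunction.sigma 0 m ≡ 2 [MOD 4] ↔
      Odd ((zagierTriples m).filter fun t => t.2.1 = t.2.2).card := by
  have hz := Finset.even_card_iff_even_card_fixed (zagierTriples m) zagierMap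
    (zagierMap_mem h4 hsq) (zagierMap_zagierMap h4 hsq)
  have hs := Finset.even_card_iff_even_card_fixed (zagierTriples m)
    (fun t => (t.1, t.2.2, t.2.1))
    (by
      rintro ⟨x, y, z⟩ ht
      obtain ⟨hx, hy, hz, h⟩ := mem_zagierTriples.1 ht
      exact mem_zagierTriples.2 ⟨hx, hz, hy, by rw [← h]; ring⟩)
    (fun _ _ => rfl)
  have hfix : ((zagierTriples m).filter fun t => (t.1, t.2.2, t.2.1) = t) =
      (zagierTriples m).filter fun t => t.2.1 = t.2.2 := by
    refine Finset.filter_congr ?_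
    rintro ⟨x, y, z⟩ -
    simp only [Prod.mk.injEq, true_and, and_true]
    omega
  rw [hfix] at hs
  rw [card_zagierMap_fixed h4] at hz
  rw [← Nat.not_even_iff_odd, ← hs, hz, ArithmeticFunction.sigma_zero_apply,
    Nat.card_divisors_eq_two_mul_card_small hsq, Nat.even_iff, Nat.ModEq]
  omega

theorem even_card_of_not_represented (N : ℕ) (h4 : N % 4 = 2)
    (hsq : ∀ k s : ℕ, k ^ 2 + s ^ 2 ≠ N) (hdiag : ∀ k y : ℕ, 2 * k ^ 2 + 4 * y ^ 2 ≠ N) :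
    Even (Set.ncard {k : ℕ | 0 < k ∧ Odd k ∧ k ^ 2 < N ∧
      ArithmeticFunction.sigma 0 (N - k ^ 2) ≡ 2 [MOD 4]}) := by
  have hodd : ∀ k : ℕ, Odd k → k ^ 2 % 4 = 1 := by
    rintro k ⟨j, rfl⟩
    have : (2 * j + 1) ^ 2 = 4 * (j ^ 2 + j) + 1 := by ring
    omega
  let K := (Finset.range (N + 1)).filter fun k => Odd k ∧ k ^ 2 < N
  let R : ℕ → Finset (ℕ × ℕ × ℕ) := fun m => (zagierTriples m).filter fun t => t.2.1 = t.2.2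
  have hset : {k : ℕ | 0 < k ∧ Odd k ∧ k ^ 2 < N ∧
      ArithmeticFunction.sigma 0 (N - k ^ 2) ≡ 2 [MOD 4]} =
      (K.filter fun k => Odd (R (N - k ^ 2)).card : Finset ℕ) := by
    ext k
    have key : Odd k → k ^ 2 < N → (ArithmeticFunction.sigma 0 (N - k ^ 2) ≡ 2 [MOD 4] ↔
        Odd (R (N - k ^ 2)).card) := by
      intro hk hlt
      have := hodd k hk
      refine sigma_zero_modEq_two_iff (by omega) ?_
      rintro ⟨s, hs⟩
      refine hsq k s ?_
      rw [pow_two s, ← hs]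
      omega
    simp only [K, Set.mem_ofPred_eq, Finset.coe_filter, Finset.mem_filter, Finset.mem_range]
    constructor
    · rintro ⟨-, hk, hlt, h⟩
      exact ⟨⟨by nlinarith, hk, hlt⟩, (key hk hlt).1 h⟩
    · rintro ⟨⟨-, hk, hlt⟩, h⟩
      exact ⟨hk.pos, hk, hlt, (key hk hlt).2 h⟩
  rw [hset, Set.ncard_coe_finset, ← Finset.even_sum_iff_even_card_odd, ← Finset.card_sigma]
  have hmem : ∀ k x y z : ℕ, (⟨k, x, y, z⟩ : Σ _ : ℕ, ℕ × ℕ × ℕ) ∈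
      K.sigma (fun k => R (N - k ^ 2)) ↔
        Odd k ∧ Odd x ∧ 0 < y ∧ y = z ∧ k ^ 2 + x ^ 2 + 4 * y * z = N := by
    intro k x y z
    simp only [K, R, Finset.mem_sigma, Finset.mem_filter, Finset.mem_range, mem_zagierTriples]
    constructor
    · rintro ⟨⟨-, hk, hlt⟩, ⟨hx, hy, hz, h⟩, hyz⟩
      refine ⟨hk, ?_, hy, hyz, by omega⟩
      by_contra hx'
      obtain ⟨j, rfl⟩ := even_iff_two_dvd.1 (Nat.not_odd_iff_even.1 hx')
      have h1 := hodd k hk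
      have h2 : N = k ^ 2 + 4 * (j ^ 2 + y * z) := by
        rw [← Nat.add_sub_cancel' hlt.le, ← h]; ring
      omega
    · rintro ⟨hk, hx, hy, rfl, h⟩
      have hy2 := Nat.mul_pos hy hy
      exact ⟨⟨by nlinarith, hk, by nlinarith⟩, ⟨hx.pos, hy, hy, by omega⟩, rfl⟩
  rw [Finset.even_card_iff_even_card_fixed _ (fun t => ⟨t.2.1, t.1, t.2.2⟩)
    (by
      rintro ⟨k, x, y, z⟩ ht
      obtain ⟨hk, hx, hy, hyz, h⟩ := (hmem k x y z).1 ht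
      exact (hmem x k y z).2 ⟨hx, hk, hy, hyz, by omega⟩)
    (fun _ _ => rfl), Finset.filter_eq_empty_iff.2]
  · simp
  · rintro ⟨k, x, y, z⟩ ht hfix
    obtain ⟨hk, hx, hy, rfl, h⟩ := (hmem k x y z).1 ht
    obtain rfl : x = k := congrArg Sigma.fst hfix
    exact hdiag x y (by rw [← h]; ring)

theorem corollary1p2 (N : ℕ) (hpos : 0 < N) (hN : N ≡ 14 [MOD 16] ∨ N ≡ 70 [MOD 196]) :
    Even (Set.ncard {k : ℕ | 0 < k ∧ Odd k ∧ k ^ 2 < N ∧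
      ArithmeticFunction.sigma 0 (N - k ^ 2) ≡ 2 [MOD 4]}) := by
  have h4 : N % 4 = 2 := by
    unfold Nat.ModEq at hN
    omega
  have sum16 : ∀ a b : ZMod 16, a ^ 2 + b ^ 2 ≠ 14 ∧ 2 * a ^ 2 + 4 * b ^ 2 ≠ 14 := by decide
  -- Both forms are anisotropic mod `7`, as `-1` and `-2` are nonresidues, so `7 ∣ N` would force
  -- `49 ∣ N`; but `70` is divisible by `7` only once.
  have sum7 : ∀ a b : ZMod 7, (a ^ 2 + b ^ 2 = 0 → a = 0 ∧ b = 0) ∧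
      (2 * a ^ 2 + 4 * b ^ 2 = 0 → a = 0 ∧ b = 0) := by decide
  have key : ∀ k s : ℕ, k ^ 2 + s ^ 2 ≠ N ∧ 2 * k ^ 2 + 4 * s ^ 2 ≠ N := by
    intro k s
    rcases hN with h | h
    · have hc : (N : ZMod 16) = 14 := (ZMod.natCast_eq_natCast_iff _ _ _).2 h
      constructor <;> intro e <;> rw [← e] at hc <;> push_cast at hc
      · exact (sum16 _ _).1 hc
      · exact (sum16 _ _).2 hc
    · have h7 : (N : ZMod 7) = 0 := (ZMod.natCast_eq_zero_iff N 7).2 (by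
        unfold Nat.ModEq at h; omega)
      have h49 : ¬ 49 ∣ N := by unfold Nat.ModEq at h; omega
      constructor <;> intro e <;> rw [← e] at h7 h49 <;> push_cast at h7
      · obtain ⟨hk, hs⟩ := (sum7 _ _).1 h7
        obtain ⟨i, rfl⟩ := (ZMod.natCast_eq_zero_iff k 7).1 hk
        obtain ⟨j, rfl⟩ := (ZMod.natCast_eq_zero_iff s 7).1 hs
        exact h49 ⟨i ^ 2 + j ^ 2, by ring⟩
      · obtain ⟨hk, hs⟩ := (sum7 _ _).2 h7
        obtain ⟨i, rfl⟩ := (ZMod.natCast_eq_zero_iff k 7).1 hk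
        obtain ⟨j, rfl⟩ := (ZMod.natCast_eq_zero_iff s 7).1 hs
        exact h49 ⟨2 * i ^ 2 + 4 * j ^ 2, by ring⟩
  exact even_card_of_not_represented N h4 (fun k s => (key k s).1) fun k s => (key k s).2
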